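/- Let $\mathcal{A}$ be a $C^*$-algebra, let $M$ be a Hilbert $C^*$-module over $\mathcal{A}$ (complete in the norm $\|x\|=\|\langle x,x\rangle\|^{1/2}$), and let $F,D$ be bounded adjointable operators on $M$ such that $\operatorname{Im}F$ and $\operatorname{Im}D$ are closed. For a subspace $N\subseteq M$ write $N^{\perp}=\{x\in M:\langle y,x\rangle=0 \text{ for all } y\in N\}$; $N$ is called orthogonally complementable if $M=N\oplus N^{\perp}$. An operator $T$ is bounded below on $N$ if there is $c>0$ with $\|Tx\|\ge c\|x\|$ for all $x\in N$. Then the orthogonal projections $P$ onto $(\ker D)^{\perp}$ and $Q$ onto $(\operatorname{Im}F)^{\perp}$ exist and are unique, and the following hold. 1. $\operatorname{Im}DF$ is closed if and only if $\ker D\cap\operatorname{Im}F$ is orthogonally complementable and $P$ is bounded below on $\operatorname{Im}F\cap(\ker D\cap\operatorname{Im}F)^{\perp}$. 2. $P$ is bounded below on $\operatorname{Im}F\cap(\ker D\cap\operatorname{Im}F)^{\perp}$ if and only if $Q$ is bounded below on $\ker D\cap(\ker D\cap\operatorname{Im}F)^{\perp}$. -/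

import Mathlib

namespace HilbertCStarModule

variable (A : Type*) {E : Type*} [NonUnitalCStarAlgebra A] [PartialOrder A]
  [SMul A E] [NormedAddCommGroup E] [NormedSpace ℂ E] [CStarModule A E]

/-- A bounded operator on a Hilbert `A`-module is adjointable if it has an adjoint with respect to
the `A`-valued inner product. Such an operator is automatically `A`-linear, see
`IsAdjointable.map_smul`. -/
def IsAdjointable (T : E →L[ℂ] E) : Prop :=
  ∃ S : E →L[ℂ] E, ∀ x y : E, inner A (T x) y = inner A x (S y)

/-- Adjointable operators are `A`-linear. -/
theorem IsAdjointable.map_smul {T : E →L[ℂ] E} (hT : IsAdjointable A T) (a : A) (x : E) :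
    T (a • x) = a • T x := by
  obtain ⟨S, hS⟩ := hT
  have h : ∀ y : E, inner A (T (a • x) - a • T x) y = 0 := fun y => by
    rw [CStarModule.inner_sub_left, hS, CStarModule.inner_op_smul_left,
      CStarModule.inner_op_smul_left, hS, sub_self]
  exact sub_eq_zero.mp (CStarModule.inner_self.mp (h _))

/-- The orthogonal complement `N^⊥` with respect to the `A`-valued inner product. -/
def orthogonal (N : Submodule ℂ E) : Submodule ℂ E where
  carrier := {x | ∀ y ∈ N, inner A y x = 0}
  zero_mem' := fun y _ => CStarModule.inner_zero_right
  add_mem' := fun {x z} hx hz y hy => by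
    rw [CStarModule.inner_add_right, hx y hy, hz y hy, add_zero]
  smul_mem' := fun c x hx y hy => by
    rw [CStarModule.inner_smul_right_complex, hx y hy, smul_zero]

/-- `N` is orthogonally complementable: the whole module is the direct sum of `N` and `N^⊥`. -/
def IsOrthComplementable (N : Submodule ℂ E) : Prop :=
  IsCompl N (orthogonal A N)

/-- `P` is the orthogonal projection onto `N`: every `x` decomposes as `P x + (x - P x)` with
`P x` in `N` and `x - P x` in `N^⊥`. -/
def IsOrthProjection (P : E →L[ℂ] E) (N : Submodule ℂ E) : Prop :=
  ∀ x : E, P x ∈ N ∧ x - P x ∈ orthogonal A N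

/-- The restriction of `T` to the subspace `N` is bounded below. -/
def IsBoundedBelowOn (T : E →L[ℂ] E) (N : Submodule ℂ E) : Prop :=
  ∃ c : ℝ, 0 < c ∧ ∀ x ∈ N, c * ‖x‖ ≤ ‖T x‖

end HilbertCStarModule

/-! Write K = ker D, R = Im F, N = K ∩ R. Hilbert modules lack automatic complements, so K and R
must first be split off. Controlled preimages make `T*` bounded below on Im T when Im T is closed;
since `⟨(TT* + t)y, y⟩ ≥ ⟨T*y, T*y⟩` for t ≥ 0, all `TT* + t` are uniformly bounded below there, and
continuation in t from large t makes `TT*` onto Im T. Solving `TT*r = Tx` splits off ker T, and Im T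
likewise.

For 1, D = DP and D is bounded below on K^⊥, so P controls D on R ∩ N^⊥. The converse applies the
kernel splitting to D(1 - Q), which has the range of DF. For 2, subtracting Qy from y ∈ K ∩ N^⊥
lands in R ∩ N^⊥, and the argument is symmetric in K and R. -/

/-- A bounded operator all of whose nonnegative translates are uniformly bounded below is
surjective. -/
theorem ContinuousLinearMap.surjective_of_forall_add_smul_boundedBelow {X : Type*}
    [NormedAddCommGroup X] [NormedSpace ℂ X] [CompleteSpace X] (S : X →L[ℂ] X) {c : ℝ}
    (hc : 0 < c) (h : ∀ t : ℝ, 0 ≤ t → ∀ x, c * ‖x‖ ≤ ‖S x + (t : ℂ) • x‖) :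
    Function.Surjective S := by
  -- Neumann series for t > ‖S‖, then descent in steps of c/2: the inverse at t + c/2 has norm at
  -- most 1/c, so perturbations smaller than c preserve invertibility.
  have key : ∀ n : ℕ, ∀ t : ℝ, 0 ≤ t → ‖S‖ < t + n * (c / 2) →
      IsUnit (S + (t : ℂ) • (1 : X →L[ℂ] X)) := by
    intro n
    induction n with
    | zero =>
      intro t ht hlt
      rcases subsingleton_or_nontrivial X with hX | hX
      · exact isUnit_of_subsingleton _
      have h1 : (-(t : ℂ)) ∈ resolventSet ℂ S := by
        apply spectrum.mem_resolventSet_of_norm_lt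
        simpa [abs_of_nonneg ht] using hlt
      rw [spectrum.mem_resolventSet_iff, Algebra.algebraMap_eq_smul_one] at h1
      convert h1.neg using 1
      module
    | succ n ih =>
      intro t ht hlt
      obtain ⟨u, hu⟩ := ih (t + c / 2) (by positivity) (by push_cast at hlt; linarith)
      rcases subsingleton_or_nontrivial X with hX | hX
      · exact isUnit_of_subsingleton _
      have hinv : ‖(↑u⁻¹ : X →L[ℂ] X)‖ ≤ c⁻¹ := by
        refine ContinuousLinearMap.opNorm_le_bound _ (by positivity) fun x => ?_
        have h2 := h (t + c / 2) (by positivity) ((↑u⁻¹ : X →L[ℂ] X) x)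
        have h3 : (u : X →L[ℂ] X) ((↑u⁻¹ : X →L[ℂ] X) x) = x := by
          rw [← mul_apply_eq_comp, Units.mul_inv, one_apply_eq_self]
        rw [hu] at h3
        have h4 : S ((↑u⁻¹ : X →L[ℂ] X) x) +
            ((t + c / 2 : ℝ) : ℂ) • ((↑u⁻¹ : X →L[ℂ] X) x) = x := by simpa using h3
        rw [h4] at h2
        rw [inv_mul_eq_div, le_div_iff₀ hc]
        linarith
      have hle : c ≤ ‖(↑u⁻¹ : X →L[ℂ] X)‖⁻¹ :=
        (le_inv_comm₀ hc (Units.norm_pos _)).mpr hinv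
      refine (u.ofNearby (S + (t : ℂ) • (1 : X →L[ℂ] X)) ?_).isUnit
      have h5 : S + (t : ℂ) • (1 : X →L[ℂ] X) - u = (-(c / 2 : ℝ) : ℂ) • (1 : X →L[ℂ] X) := by
        rw [hu]; push_cast; module
      rw [h5, norm_smul, norm_one, norm_neg, Complex.norm_real, Real.norm_eq_abs,
        abs_of_pos (by positivity)]
      linarith
  obtain ⟨n, hn⟩ := exists_nat_gt (‖S‖ / (c / 2))
  have hu := key n 0 le_rfl (by rw [div_lt_iff₀ (by positivity)] at hn; linarith)
  have hu' : IsUnit S := by simpa using hu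
  exact (ContinuousLinearMap.isUnit_iff_bijective.mp hu').2

/-- An operator between Banach spaces with closed range admits norm-controlled preimages. -/
theorem ContinuousLinearMap.exists_preimage_norm_le_of_isClosed_range {X Y : Type*}
    [NormedAddCommGroup X] [NormedSpace ℂ X] [CompleteSpace X]
    [NormedAddCommGroup Y] [NormedSpace ℂ Y] [CompleteSpace Y] (T : X →L[ℂ] Y)
    (hT : IsClosed (Set.range T)) :
    ∃ C : ℝ, 0 < C ∧ ∀ x, ∃ x', T x' = T x ∧ ‖x'‖ ≤ C * ‖T x‖ := by
  have : CompleteSpace T.range :=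
    (show IsClosed (T.range : Set Y) from hT).completeSpace_coe
  obtain ⟨C, hC, hpre⟩ := ContinuousLinearMap.exists_preimage_norm_le
    (T.codRestrict T.range fun x => ⟨x, rfl⟩) (by
      rintro ⟨_, x, rfl⟩
      exact ⟨x, rfl⟩)
  refine ⟨C, hC, fun x => ?_⟩
  obtain ⟨x', hx', hn⟩ := hpre ⟨T x, x, rfl⟩
  exact ⟨x', congrArg Subtype.val hx', hn⟩

namespace HilbertCStarModule

/-! ### Orthogonal complements and projections -/

section Orthogonal

variable {A E : Type*} [NonUnitalCStarAlgebra A] [PartialOrder A]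
  [SMul A E] [NormedAddCommGroup E] [NormedSpace ℂ E] [CStarModule A E]

theorem inner_eq_zero_symm {x y : E} (h : inner A x y = 0) : inner A y x = 0 := by
  rw [← CStarModule.star_inner, h, star_zero]

theorem orthogonal_anti {N L : Submodule ℂ E} (h : N ≤ L) : orthogonal A L ≤ orthogonal A N :=
  fun _ hx y hy => hx y (h hy)

theorem le_orthogonal_orthogonal (N : Submodule ℂ E) : N ≤ orthogonal A (orthogonal A N) :=
  fun x hx _ hy => inner_eq_zero_symm (hy x hx)

theorem eq_zero_of_mem_of_mem_orthogonal {N : Submodule ℂ E} {x : E} (hx : x ∈ N)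
    (hx' : x ∈ orthogonal A N) : x = 0 :=
  CStarModule.inner_self.mp (hx' x hx)

/-- To be orthogonally complementable it suffices that `N` and `N^⊥` span. -/
theorem isOrthComplementable_of_forall_exists {N : Submodule ℂ E}
    (h : ∀ x, ∃ n ∈ N, x - n ∈ orthogonal A N) : IsOrthComplementable A N := by
  refine ⟨Submodule.disjoint_def.mpr fun x hx hx' => eq_zero_of_mem_of_mem_orthogonal hx hx',
    codisjoint_iff.mpr (eq_top_iff.mpr fun x _ => ?_)⟩
  obtain ⟨n, hn, hn'⟩ := h x
  exact Submodule.mem_sup.mpr ⟨n, hn, x - n, hn', by abel⟩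

theorem IsOrthComplementable.exists_sub_mem {N : Submodule ℂ E} (h : IsOrthComplementable A N)
    (x : E) : ∃ n ∈ N, x - n ∈ orthogonal A N := by
  have hx : x ∈ N ⊔ orthogonal A N := by rw [h.sup_eq_top]; trivial
  obtain ⟨n, hn, z, hz, rfl⟩ := Submodule.mem_sup.mp hx
  exact ⟨n, hn, by simpa using hz⟩

theorem IsOrthComplementable.orthogonal_orthogonal {N : Submodule ℂ E}
    (h : IsOrthComplementable A N) : orthogonal A (orthogonal A N) = N := by
  refine le_antisymm (fun x hx => ?_) (le_orthogonal_orthogonal N)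
  obtain ⟨n, hn, hn'⟩ := h.exists_sub_mem x
  have h0 : x - n = 0 := eq_zero_of_mem_of_mem_orthogonal hn'
    (Submodule.sub_mem _ hx (le_orthogonal_orthogonal N hn))
  rwa [sub_eq_zero.mp h0]

theorem IsOrthProjection.eq {P P' : E →L[ℂ] E} {N : Submodule ℂ E}
    (hP : IsOrthProjection A P N) (hP' : IsOrthProjection A P' N) : P = P' := by
  ext x
  refine sub_eq_zero.mp (eq_zero_of_mem_of_mem_orthogonal (A := A)
    (Submodule.sub_mem _ (hP x).1 (hP' x).1) ?_)
  have h := Submodule.sub_mem _ (hP' x).2 (hP x).2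
  rwa [sub_sub_sub_cancel_left] at h

/-- The range of the complementary projection lies in the original submodule. -/
theorem IsOrthProjection.sub_apply_mem {P : E →L[ℂ] E} {N : Submodule ℂ E}
    (hP : IsOrthProjection A P (orthogonal A N)) (hN : IsOrthComplementable A N) (x : E) :
    x - P x ∈ N := by
  have h := (hP x).2
  rwa [hN.orthogonal_orthogonal] at h

theorem IsOrthProjection.apply_eq_zero {P : E →L[ℂ] E} {N : Submodule ℂ E}
    (hP : IsOrthProjection A P (orthogonal A N)) {x : E} (hx : x ∈ N) : P x = 0 := by
  refine eq_zero_of_mem_of_mem_orthogonal (A := A) (hP x).1 ?_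
  have h := Submodule.sub_mem _ (le_orthogonal_orthogonal (A := A) N hx) (hP x).2
  rwa [sub_sub_cancel] at h

theorem IsOrthProjection.isAdjointable {P : E →L[ℂ] E} {N : Submodule ℂ E}
    (hP : IsOrthProjection A P N) : IsAdjointable A P := by
  refine ⟨P, fun x y => ?_⟩
  have h1 : inner A (P x) (y - P y) = 0 := (hP y).2 _ (hP x).1
  have h2 : inner A (x - P x) (P y) = 0 := inner_eq_zero_symm ((hP x).2 _ (hP y).1)
  rw [CStarModule.inner_sub_right, sub_eq_zero] at h1
  rw [CStarModule.inner_sub_left, sub_eq_zero] at h2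
  rw [h1, h2]

end Orthogonal

/-! ### Norm estimates from orthogonality -/

section Norm

variable {A E : Type*} [NonUnitalCStarAlgebra A] [PartialOrder A] [StarOrderedRing A]
  [SMul A E] [NormedAddCommGroup E] [NormedSpace ℂ E] [CStarModule A E]

/-- Pythagoras holds for the `A`-valued squares but not for norms; monotonicity of the norm on
positive elements leaves this inequality. -/
theorem norm_le_norm_add_of_inner_eq_zero {x y : E} (h : inner A x y = 0) : ‖x‖ ≤ ‖x + y‖ := by
  refine le_of_sq_le_sq ?_ (norm_nonneg _)
  rw [CStarModule.norm_sq_eq A, CStarModule.norm_sq_eq A]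
  refine CStarAlgebra.norm_le_norm_of_nonneg_of_le CStarModule.inner_self_nonneg ?_
  have h' : inner A (x + y) (x + y) = inner A x x + inner A y y := by
    simp [h, inner_eq_zero_symm h]
  rw [h']
  exact le_add_of_nonneg_right CStarModule.inner_self_nonneg

theorem IsOrthProjection.norm_apply_le {P : E →L[ℂ] E} {N : Submodule ℂ E}
    (hP : IsOrthProjection A P N) (x : E) : ‖P x‖ ≤ ‖x‖ := by
  simpa using norm_le_norm_add_of_inner_eq_zero ((hP x).2 _ (hP x).1)

theorem isClosed_orthogonal (N : Submodule ℂ E) : IsClosed (orthogonal A N : Set E) := by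
  have h : (orthogonal A N : Set E) = ⋂ y ∈ N, {x | inner A y x = 0} := by
    ext x; simp [orthogonal]
  rw [h]
  refine isClosed_biInter fun y _ => isClosed_eq ?_ continuous_const
  exact CStarModule.continuous_inner.comp (Continuous.prodMk_right y)

/-- Orthogonally complementable submodules have a bounded projection onto their complement. -/
theorem IsOrthComplementable.exists_isOrthProjection {N : Submodule ℂ E}
    (h : IsOrthComplementable A N) : ∃ P : E →L[ℂ] E, IsOrthProjection A P (orthogonal A N) := by
  choose p hp hp' using h.exists_sub_mem
  have huniq : ∀ x n, n ∈ N → x - n ∈ orthogonal A N → p x = n := fun x n hn hn' => by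
    refine sub_eq_zero.mp (eq_zero_of_mem_of_mem_orthogonal (A := A)
      (Submodule.sub_mem _ (hp x) hn) ?_)
    have h := Submodule.sub_mem _ hn' (hp' x)
    rwa [sub_sub_sub_cancel_left] at h
  let P : E →ₗ[ℂ] E :=
    { toFun := fun x => x - p x
      map_add' := fun x y => by
        rw [huniq (x + y) (p x + p y) (Submodule.add_mem _ (hp x) (hp y))
          (by rw [add_sub_add_comm]; exact Submodule.add_mem _ (hp' x) (hp' y))]
        abel
      map_smul' := fun c x => by
        rw [huniq (c • x) (c • p x) (Submodule.smul_mem _ c (hp x))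
          (by rw [← smul_sub]; exact Submodule.smul_mem _ c (hp' x))]
        simp [smul_sub] }
  refine ⟨P.mkContinuous 1 fun x => ?_, fun x => ⟨hp' x, ?_⟩⟩
  · have h := norm_le_norm_add_of_inner_eq_zero (inner_eq_zero_symm (hp' x (p x) (hp x)))
    rw [sub_add_cancel] at h
    simpa [P] using h
  · have h : x - (x - p x) ∈ orthogonal A (orthogonal A N) := by
      rw [sub_sub_cancel]
      exact le_orthogonal_orthogonal N (hp x)
    exact h

theorem IsOrthComplementable.existsUnique_isOrthProjection {N : Submodule ℂ E}
    (h : IsOrthComplementable A N) :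
    ∃! P : E →L[ℂ] E, IsOrthProjection A P (orthogonal A N) := by
  obtain ⟨P, hP⟩ := h.exists_isOrthProjection
  exact ⟨P, hP, fun P' hP' => hP'.eq hP⟩

/-- The bounded-below condition passes from one of two complementable submodules to the other. -/
theorem IsBoundedBelowOn.swap {K R : Submodule ℂ E} (hR : IsOrthComplementable A R)
    {P Q : E →L[ℂ] E} (hP : IsOrthProjection A P (orthogonal A K))
    (hQ : IsOrthProjection A Q (orthogonal A R))
    (h : IsBoundedBelowOn P (R ⊓ orthogonal A (K ⊓ R))) :
    IsBoundedBelowOn Q (K ⊓ orthogonal A (K ⊓ R)) := by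
  obtain ⟨c, hc, h⟩ := h
  refine ⟨(1 + c⁻¹)⁻¹, by positivity, fun y hy => ?_⟩
  have hx : y - Q y ∈ R ⊓ orthogonal A (K ⊓ R) :=
    ⟨hQ.sub_apply_mem hR y,
      Submodule.sub_mem _ hy.2 (orthogonal_anti inf_le_right (hQ y).1)⟩
  -- P kills y ∈ K, so P(y - Qy) = -P(Qy).
  have h1 : c * ‖y - Q y‖ ≤ ‖Q y‖ := by
    refine (h _ hx).trans ?_
    rw [map_sub, hP.apply_eq_zero hy.1, zero_sub, norm_neg]
    exact hP.norm_apply_le _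
  have h2 : ‖y - Q y‖ ≤ c⁻¹ * ‖Q y‖ := by
    rw [inv_mul_eq_div, le_div_iff₀ hc]
    linarith
  have h3 : ‖y‖ ≤ ‖y - Q y‖ + ‖Q y‖ := by simpa using norm_add_le (y - Q y) (Q y)
  rw [inv_mul_eq_div, div_le_iff₀ (by positivity)]
  linarith

/-! ### Adjointable operators with closed range -/

variable [CompleteSpace E]

/-- For adjointable `T` with closed range, `T T*` maps the range of `T` onto itself. -/
theorem exists_mem_range_apply_apply_adjoint_eq {T S : E →L[ℂ] E}
    (hTS : ∀ x y : E, inner A (T x) y = inner A x (S y)) (hT : IsClosed (Set.range T)) (x : E) :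
    ∃ r ∈ T.range, T (S r) = T x := by
  obtain ⟨C, hC, hpre⟩ := T.exists_preimage_norm_le_of_isClosed_range hT
  have : CompleteSpace T.range :=
    (show IsClosed (T.range : Set E) from hT).completeSpace_coe
  -- With z' a controlled preimage of Tz, ‖Tz‖² = ‖⟨z', S(Tz)⟩‖; apply Cauchy–Schwarz.
  have hS : ∀ y ∈ T.range, ‖y‖ ≤ C * ‖S y‖ := by
    rintro _ ⟨z, rfl⟩
    obtain ⟨z', hz', hn⟩ := hpre z
    change ‖T z‖ ≤ C * ‖S (T z)‖
    rcases eq_or_lt_of_le (norm_nonneg (T z)) with h0 | h0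
    · rw [← h0]; positivity
    refine le_of_mul_le_mul_right ?_ h0
    calc ‖T z‖ * ‖T z‖ = ‖inner A (T z') (T z)‖ := by
          rw [hz', ← CStarModule.norm_sq_eq A, sq]
      _ = ‖inner A z' (S (T z))‖ := by rw [hTS]
      _ ≤ ‖z'‖ * ‖S (T z)‖ := CStarModule.norm_inner_le E
      _ ≤ C * ‖T z‖ * ‖S (T z)‖ := by gcongr
      _ = C * ‖S (T z)‖ * ‖T z‖ := by ring
  let W : T.range →L[ℂ] T.range :=
    (T ∘L S ∘L T.range.subtypeL).codRestrict T.range fun y => ⟨_, rfl⟩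
  have hW : Function.Surjective W := by
    refine W.surjective_of_forall_add_smul_boundedBelow (c := (C ^ 2)⁻¹) (by positivity) ?_
    rintro t ht ⟨y, hy⟩
    change (C ^ 2)⁻¹ * ‖y‖ ≤ ‖T (S y) + (t : ℂ) • y‖
    rw [inv_mul_eq_div, div_le_iff₀ (by positivity)]
    rcases eq_or_lt_of_le (norm_nonneg y) with h0 | h0
    · rw [← h0]; positivity
    refine le_of_mul_le_mul_right ?_ h0
    have hinner : inner A (T (S y) + (t : ℂ) • y) y = inner A (S y) (S y) + t • inner A y y := by
      rw [CStarModule.inner_add_left, hTS, CStarModule.inner_smul_left_complex]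
      simp
    calc ‖y‖ * ‖y‖ ≤ (C * ‖S y‖) * (C * ‖S y‖) := by gcongr <;> exact hS y hy
      _ = C ^ 2 * ‖inner A (S y) (S y)‖ := by rw [← CStarModule.norm_sq_eq A]; ring
      _ ≤ C ^ 2 * ‖inner A (T (S y) + (t : ℂ) • y) y‖ := by
          gcongr
          refine CStarAlgebra.norm_le_norm_of_nonneg_of_le CStarModule.inner_self_nonneg ?_
          rw [hinner]
          exact le_add_of_nonneg_right (smul_nonneg ht CStarModule.inner_self_nonneg)
      _ ≤ C ^ 2 * (‖T (S y) + (t : ℂ) • y‖ * ‖y‖) := by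
          gcongr
          exact CStarModule.norm_inner_le E
      _ = ‖T (S y) + (t : ℂ) • y‖ * C ^ 2 * ‖y‖ := by ring
  obtain ⟨r, hr⟩ := hW ⟨T x, x, rfl⟩
  exact ⟨r, r.2, congrArg Subtype.val hr⟩

theorem IsAdjointable.isOrthComplementable_ker {T : E →L[ℂ] E} (hT : IsAdjointable A T)
    (hTc : IsClosed (Set.range T)) : IsOrthComplementable A T.ker := by
  obtain ⟨S, hS⟩ := hT
  refine isOrthComplementable_of_forall_exists fun x => ?_
  obtain ⟨r, -, hr⟩ := exists_mem_range_apply_apply_adjoint_eq hS hTc x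
  refine ⟨x - S r, ?_, fun y hy => ?_⟩
  · change T (x - S r) = 0
    rw [map_sub, hr, sub_self]
  · rw [sub_sub_cancel, ← hS, show T y = 0 from hy, CStarModule.inner_zero_left]

theorem IsAdjointable.isOrthComplementable_range {T : E →L[ℂ] E} (hT : IsAdjointable A T)
    (hTc : IsClosed (Set.range T)) : IsOrthComplementable A T.range := by
  obtain ⟨S, hS⟩ := hT
  refine isOrthComplementable_of_forall_exists fun x => ?_
  obtain ⟨r, hr, hr'⟩ := exists_mem_range_apply_apply_adjoint_eq hS hTc (S x)
  refine ⟨r, hr, ?_⟩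
  -- ⟨S(x - r), S(x - r)⟩ = ⟨TS(x - r), x - r⟩, and TSr = TSx.
  have h0 : S (x - r) = 0 := by
    refine CStarModule.inner_self (A := A).mp ?_
    rw [← hS, map_sub, map_sub, hr', sub_self, CStarModule.inner_zero_left]
  rintro _ ⟨z, rfl⟩
  change inner A (T z) (x - r) = 0
  rw [hS, h0, CStarModule.inner_zero_right]

variable (A) in
-- A controlled preimage of Tx differs from x by a kernel element, which is orthogonal to x, so it
-- is at least as long as x.
theorem isBoundedBelowOn_orthogonal_ker {T : E →L[ℂ] E} (hTc : IsClosed (Set.range T)) :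
    IsBoundedBelowOn T (orthogonal A T.ker) := by
  obtain ⟨C, hC, hpre⟩ := T.exists_preimage_norm_le_of_isClosed_range hTc
  refine ⟨C⁻¹, by positivity, fun x hx => ?_⟩
  obtain ⟨x', hx', hn⟩ := hpre x
  have hk : x' - x ∈ T.ker := by
    change T (x' - x) = 0
    rw [map_sub, hx', sub_self]
  have h := norm_le_norm_add_of_inner_eq_zero (inner_eq_zero_symm (hx _ hk))
  rw [add_sub_cancel] at h
  rw [inv_mul_eq_div, div_le_iff₀ hC]
  linarith

theorem isClosed_range_comp_of_isBoundedBelowOn {F D P : E →L[ℂ] E}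
    (hFc : IsClosed (Set.range F)) (hDc : IsClosed (Set.range D))
    (hK : IsOrthComplementable A D.ker) (hP : IsOrthProjection A P (orthogonal A D.ker))
    (hN : IsOrthComplementable A (D.ker ⊓ F.range))
    (hb : IsBoundedBelowOn P (F.range ⊓ orthogonal A (D.ker ⊓ F.range))) :
    IsClosed (Set.range (D ∘L F)) := by
  set X := F.range ⊓ orthogonal A (D.ker ⊓ F.range)
  have hXc : IsClosed (X : Set E) :=
    (show IsClosed (F.range : Set E) from hFc).inter (isClosed_orthogonal _)
  have : CompleteSpace X := hXc.completeSpace_coe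
  obtain ⟨c, hc, hb⟩ := hb
  obtain ⟨d, hd, hD⟩ := isBoundedBelowOn_orthogonal_ker A hDc
  have hDP : ∀ x, D (P x) = D x := fun x => by
    have h : D (x - P x) = 0 := hP.sub_apply_mem hK x
    rw [map_sub, sub_eq_zero] at h
    exact h.symm
  have hlow : ∀ x : X, d * c * ‖x‖ ≤ ‖(D ∘L X.subtypeL) x‖ := fun x => by
    calc d * c * ‖x‖ = d * (c * ‖(x : E)‖) := by rw [mul_assoc]; rfl
      _ ≤ d * ‖P x‖ := by gcongr; exact hb x x.2
      _ ≤ ‖D (P x)‖ := hD _ (hP x).1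
      _ = ‖(D ∘L X.subtypeL) x‖ := by rw [hDP]; rfl
  have hanti : AntilipschitzWith (Real.toNNReal (d * c)⁻¹) (D ∘L X.subtypeL) := by
    refine AddMonoidHomClass.antilipschitz_of_bound _ fun x => ?_
    rw [Real.coe_toNNReal _ (by positivity), inv_mul_eq_div, le_div_iff₀ (by positivity)]
    linarith [hlow x]
  have hcl := hanti.isClosed_range (D ∘L X.subtypeL).uniformContinuous
  -- Removing the N-component of Fy leaves its image under D unchanged, so Im DF = D(R ∩ N^⊥).
  convert hcl using 1
  ext z
  constructor
  · rintro ⟨y, rfl⟩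
    obtain ⟨n, hn, hn'⟩ := hN.exists_sub_mem (F y)
    refine ⟨⟨F y - n, Submodule.sub_mem _ ⟨y, rfl⟩ hn.2, hn'⟩, ?_⟩
    change D (F y - n) = D (F y)
    rw [map_sub, show D n = 0 from hn.1, sub_zero]
  · rintro ⟨⟨_, ⟨y, rfl⟩, _⟩, rfl⟩
    exact ⟨y, rfl⟩

theorem isOrthComplementable_inf_and_isBoundedBelowOn_of_isClosed_range_comp
    {F D P Q : E →L[ℂ] E} (hD : IsAdjointable A D)
    (hK : IsOrthComplementable A D.ker) (hR : IsOrthComplementable A F.range)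
    (hP : IsOrthProjection A P (orthogonal A D.ker))
    (hQ : IsOrthProjection A Q (orthogonal A F.range))
    (hc : IsClosed (Set.range (D ∘L F))) :
    IsOrthComplementable A (D.ker ⊓ F.range) ∧
      IsBoundedBelowOn P (F.range ⊓ orthogonal A (D.ker ⊓ F.range)) := by
  let G : E →L[ℂ] E := D ∘L (1 - Q)
  have hG : ∀ x, G x = D (x - Q x) := fun _ => rfl
  have hGR : ∀ x ∈ F.range, G x = D x := fun x hx => by
    rw [hG, hQ.apply_eq_zero hx, sub_zero]
  have hGc : IsClosed (Set.range G) := by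
    convert hc using 1
    ext z
    constructor
    · rintro ⟨x, rfl⟩
      obtain ⟨y, hy⟩ := hQ.sub_apply_mem hR x
      exact ⟨y, congrArg D hy⟩
    · rintro ⟨y, rfl⟩
      exact ⟨F y, hGR _ ⟨y, rfl⟩⟩
  have hGa : IsAdjointable A G := by
    obtain ⟨S, hS⟩ := hD
    obtain ⟨Q', hQ'⟩ := hQ.isAdjointable
    refine ⟨(1 - Q') ∘L S, fun x y => ?_⟩
    change inner A (D (x - Q x)) y = inner A x (S y - Q' (S y))
    rw [hS, CStarModule.inner_sub_left, hQ', CStarModule.inner_sub_right]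
  have hNker : D.ker ⊓ F.range ≤ G.ker := fun x hx => (hGR x hx.2).trans hx.1
  have hRker : orthogonal A F.range ≤ G.ker := fun x hx => by
    change G x = 0
    have h : x - Q x = 0 := eq_zero_of_mem_of_mem_orthogonal (hQ.sub_apply_mem hR x)
      (Submodule.sub_mem _ hx (hQ x).1)
    rw [hG, h, map_zero]
  have hGK := hGa.isOrthComplementable_ker hGc
  constructor
  · refine isOrthComplementable_of_forall_exists fun x => ?_
    -- The part in (ker G)^⊥ lies in R^⊥⊥ = R, hence so does a; on R the operators G and D agree, so
    -- a ∈ N.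
    obtain ⟨a, ha, hb⟩ := hGK.exists_sub_mem (x - Q x)
    have hbR : x - Q x - a ∈ F.range := by
      have h := orthogonal_anti hRker hb
      rwa [hR.orthogonal_orthogonal] at h
    have haR : a ∈ F.range := by
      have h := Submodule.sub_mem _ (hQ.sub_apply_mem hR x) hbR
      rwa [sub_sub_cancel] at h
    refine ⟨a, ⟨(hGR a haR).symm.trans ha, haR⟩, ?_⟩
    have h := Submodule.add_mem _ (orthogonal_anti hNker hb)
      (orthogonal_anti (A := A) (inf_le_right : D.ker ⊓ F.range ≤ F.range) (hQ x).1)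
    convert h using 1
    abel
  · obtain ⟨c, hc0, hlow⟩ := isBoundedBelowOn_orthogonal_ker A hGc
    -- From c‖x‖ ≤ ‖Gx‖ = ‖DPx‖ ≤ ‖D‖‖Px‖; the added 1 covers D = 0.
    refine ⟨c / (‖D‖ + 1), by positivity, fun x hx => ?_⟩
    have hxG : x ∈ orthogonal A G.ker := fun y hy => by
      have hyR := hQ.sub_apply_mem hR y
      have h1 : inner A (y - Q y) x = 0 := hx.2 _ ⟨hy, hyR⟩
      have h2 : inner A (Q y) x = 0 := inner_eq_zero_symm ((hQ y).1 x hx.1)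
      rw [CStarModule.inner_sub_left, h2, sub_zero] at h1
      exact h1
    have hDP : D (P x) = D x := by
      have h : D (x - P x) = 0 := hP.sub_apply_mem hK x
      rw [map_sub, sub_eq_zero] at h
      exact h.symm
    rw [div_mul_eq_mul_div, div_le_iff₀ (by positivity)]
    calc c * ‖x‖ ≤ ‖G x‖ := hlow x hxG
      _ = ‖D (P x)‖ := by rw [hGR x hx.1, hDP]
      _ ≤ ‖D‖ * ‖P x‖ := D.le_opNorm _
      _ ≤ ‖P x‖ * (‖D‖ + 1) := by nlinarith [norm_nonneg (P x)]

end Norm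

end HilbertCStarModule

theorem mainTheorem6 {A E : Type*} [NonUnitalCStarAlgebra A] [PartialOrder A] [StarOrderedRing A]
    [SMul A E] [NormedAddCommGroup E] [NormedSpace ℂ E] [CompleteSpace E] [CStarModule A E]
    (F D : E →L[ℂ] E)
    (hF : HilbertCStarModule.IsAdjointable A F) (hD : HilbertCStarModule.IsAdjointable A D)
    (hFc : IsClosed (Set.range F)) (hDc : IsClosed (Set.range D)) :
    (∃! P : E →L[ℂ] E, HilbertCStarModule.IsOrthProjection A P
      (HilbertCStarModule.orthogonal A D.ker)) ∧
    (∃! Q : E →L[ℂ] E, HilbertCStarModule.IsOrthProjection A Q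
      (HilbertCStarModule.orthogonal A F.range)) ∧
    ∀ P Q : E →L[ℂ] E,
      HilbertCStarModule.IsOrthProjection A P (HilbertCStarModule.orthogonal A D.ker) →
      HilbertCStarModule.IsOrthProjection A Q (HilbertCStarModule.orthogonal A F.range) →
      (IsClosed (Set.range (D ∘L F)) ↔
        HilbertCStarModule.IsOrthComplementable A (D.ker ⊓ F.range) ∧
        HilbertCStarModule.IsBoundedBelowOn P
          (F.range ⊓ HilbertCStarModule.orthogonal A (D.ker ⊓ F.range))) ∧
      (HilbertCStarModule.IsBoundedBelowOn P
          (F.range ⊓ HilbertCStarModule.orthogonal A (D.ker ⊓ F.range)) ↔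
        HilbertCStarModule.IsBoundedBelowOn Q
          (D.ker ⊓ HilbertCStarModule.orthogonal A (D.ker ⊓ F.range))) := by
  have hK := hD.isOrthComplementable_ker hDc
  have hR := hF.isOrthComplementable_range hFc
  refine ⟨hK.existsUnique_isOrthProjection, hR.existsUnique_isOrthProjection,
    fun P Q hP hQ => ⟨⟨fun hc => ?_, fun h => ?_⟩, fun h => h.swap hR hP hQ, fun h => ?_⟩⟩
  · exact HilbertCStarModule.isOrthComplementable_inf_and_isBoundedBelowOn_of_isClosed_range_comp
      hD hK hR hP hQ hc
  · exact HilbertCStarModule.isClosed_range_comp_of_isBoundedBelowOn hFc hDc hK hP h.1 h.2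
  · rw [inf_comm D.ker F.range] at h ⊢
    exact h.swap hK hQ hP
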